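/- Let $d$ be a positive integer and let $\mathcal D$ be the set of $d\times d$ density matrices, that is, complex positive semidefinite matrices $\rho$ with $\operatorname{Tr}\rho=1$. For $\rho\in\mathcal D$ let $\lambda(\rho)=(\lambda_1,\dots,\lambda_d)$ be the vector of its eigenvalues, with multiplicity, in non-increasing order. Let $\mathcal F$ be the class of functions $f:\mathcal D\to\mathbb R$ that are concave on $\mathcal D$ and for which there is a permutation-invariant function $\varphi:\mathbb R^d\to\mathbb R$ with $f(\rho)=\varphi(\lambda(\rho))$ for all $\rho\in\mathcal D$. For $a\in[0,1]$ and $\rho,\sigma\in\mathcal D$ put $$\rho\boxplus_a\sigma := a\rho+(1-a)\sigma-\sqrt{a(1-a)}\;i\,(\rho\sigma-\sigma\rho).$$ Then for all $\rho,\sigma\in\mathcal D$, $a\in[0,1]$ and $f\in\mathcal F$, the matrix $\rho\boxplus_a\sigma$ is again in $\mathcal D$ and $$f(\rho\boxplus_a\sigma)\;\ge\; a\,f(\rho)+(1-a)\,f(\sigma).$$ Moreover, the following functions belong to $\mathcal F$, so the inequality holds for each of them: 1. the von Neumann entropy $H(\rho)=-\sum_{i}\lambda_i\log\lambda_i$ (with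 $0\log 0=0$); 2. for every $\alpha\in[0,1)$, the Rényi entropy $H_\alpha(\rho)=\frac{1}{1-\alpha}\log\sum_{i:\lambda_i\neq0}\lambda_i^\alpha$ (so $H_0(\rho)=\log\operatorname{rank}\rho$); 3. the subentropy $$Q(\rho)=\lim_{\mu\to\lambda(\rho)}\Bigl(-\sum_{i=1}^d\frac{\mu_i^d}{\prod_{j\ne i}(\mu_i-\mu_j)}\log\mu_i\Bigr),$$ the limit being over vectors $\mu\in\mathbb R^d$ with pairwise distinct positive entries; this limit exists and is finite for every $\rho\in\mathcal D$. -/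

import Mathlib

open scoped Topology ComplexOrder

namespace QuditEPI

/-- The set `𝒟(ℂ^d)` of density matrices: positive semidefinite matrices of trace one. -/
def densityMatrices (d : ℕ) : Set (Matrix (Fin d) (Fin d) ℂ) :=
  {ρ | ρ.PosSemidef ∧ ρ.trace = 1}

open Classical in
/-- The vector of eigenvalues of a Hermitian matrix, with multiplicity and in non-increasing order.
(The value `0` at non-Hermitian matrices is never used.) -/
noncomputable def spectrumVec {d : ℕ} (A : Matrix (Fin d) (Fin d) ℂ) : Fin d → ℝ :=
  if hA : A.IsHermitian then
    fun i => hA.eigenvalues₀ (Fin.cast (Fintype.card_fin d).symm i)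
  else 0

/-- The partial swap addition rule `a ρ + (1 - a) σ - √(a (1 - a)) i [ρ, σ]`. -/
noncomputable def boxplus {d : ℕ} (a : ℝ) (ρ σ : Matrix (Fin d) (Fin d) ℂ) :
    Matrix (Fin d) (Fin d) ℂ :=
  a • ρ + (1 - a) • σ - ((Real.sqrt (a * (1 - a)) : ℂ) * Complex.I) • (ρ * σ - σ * ρ)

/-- The class of functions on density matrices that are concave and are given by a
permutation-invariant function of the eigenvalues. Only the values of `f` on density matrices
are constrained. -/
def classF (d : ℕ) : Set (Matrix (Fin d) (Fin d) ℂ → ℝ) :=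
  {f | ConcaveOn ℝ (densityMatrices d) f ∧
    ∃ φ : (Fin d → ℝ) → ℝ,
      (∀ (π : Equiv.Perm (Fin d)) (v : Fin d → ℝ), φ (v ∘ π) = φ v) ∧
      ∀ ρ ∈ densityMatrices d, f ρ = φ (spectrumVec ρ)}

/-- The von Neumann entropy `- ∑ᵢ λᵢ log λᵢ`, with `0 log 0 = 0`. -/
noncomputable def vonNeumannEntropy {d : ℕ} (ρ : Matrix (Fin d) (Fin d) ℂ) : ℝ :=
  - ∑ i, spectrumVec ρ i * Real.log (spectrumVec ρ i)

/-- The Rényi entropy `(1 - α)⁻¹ log Tr ρ^α`. The power is taken on the support of `ρ`, which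
matters only for `α = 0`, where the entropy is the logarithm of the rank. -/
noncomputable def renyiEntropy {d : ℕ} (α : ℝ) (ρ : Matrix (Fin d) (Fin d) ℂ) : ℝ :=
  1 / (1 - α) * Real.log (∑ i with spectrumVec ρ i ≠ 0, spectrumVec ρ i ^ α)

/-- The subentropy expression in terms of distinct positive eigenvalues. -/
noncomputable def subentropyExpr {d : ℕ} (μ : Fin d → ℝ) : ℝ :=
  - ∑ i, μ i ^ d / (∏ j ∈ Finset.univ.erase i, (μ i - μ j)) * Real.log (μ i)

/-- Vectors with distinct positive entries tending to the eigenvalue vector of `ρ`. -/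
noncomputable def genericNhds {d : ℕ} (ρ : Matrix (Fin d) (Fin d) ℂ) : Filter (Fin d → ℝ) :=
  𝓝[{μ | Function.Injective μ ∧ ∀ i, 0 < μ i}] (spectrumVec ρ)

/-- The subentropy, as the limit of the above expression when distinct positive numbers tend to
the eigenvalues of `ρ`. -/
noncomputable def subentropy {d : ℕ} (ρ : Matrix (Fin d) (Fin d) ℂ) : ℝ :=
  Filter.limUnder (genericNhds ρ) subentropyExpr

end QuditEPI

/-!
For a projection `P` add to `Tr (P ρ)` the squared norm of the block `P ρ (1 - P)`. By AM-GM these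
squares absorb the commutator term, so `Tr (P (ρ ⊞ σ))` is at most the `a`-average of the
functional at `ρ` and `σ`. The functional is convex in `ρ`, and on projections it is elementary;
by layer-cake decomposition it is at most the sum of the `rank P` largest eigenvalues of `ρ`. Hence
the spectrum of `ρ ⊞ σ` is majorized by `a λ(ρ) + (1 - a) λ(σ)`, and symmetric concave functions
are Schur-concave. Concavity of the subentropy comes from an integral over `t > 0` of
`1 - (∑ i, μ i) / (1 + t) - ∏ i, t / (t + μ i)`, whose integrand is concave in `μ`.
-/

namespace QuditEPI

section Majorization

open MeasureTheory

variable {ι : Type*}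

-- The layer-cake formula: `l` is the average over `t ∈ (0, 1]` of the indicators of `{t ≤ l}`.
theorem mem_convexHull_indicator_of_antitone [Finite ι] [Preorder ι] {l : ι → ℝ} (hl : Antitone l)
    (h0 : ∀ k, 0 ≤ l k) (h1 : ∀ k, l k ≤ 1) :
    l ∈ convexHull ℝ ((fun T : Finset ι => (T : Set ι).indicator (1 : ι → ℝ)) ''
      {T | IsLowerSet (T : Set ι)}) := by
  classical
  cases nonempty_fintype ι
  set H := convexHull ℝ ((fun T : Finset ι => (T : Set ι).indicator (1 : ι → ℝ)) ''
    {T | IsLowerSet (T : Set ι)})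
  have hclosed : IsClosed H := ((Set.toFinite _).isCompact_convexHull (𝕜 := ℝ)).isClosed
  let f : ℝ → ι → ℝ := fun t k => (Set.Iic (l k)).indicator 1 t
  have hf (t : ℝ) : f t ∈ H := by
    refine subset_convexHull ℝ _ ⟨Finset.univ.filter (t ≤ l ·), fun i j hji hi => ?_, ?_⟩
    · simp only [Finset.coe_filter, Finset.mem_univ, true_and, Set.mem_ofPred_eq] at hi ⊢
      exact hi.trans (hl hji)
    · ext k
      simp [f, Set.indicator_apply]
  have hint (k : ι) : IntegrableOn (fun t => f t k) (Set.Ioc 0 1) :=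
    (integrable_const 1).indicator measurableSet_Iic
  have hprob : IsProbabilityMeasure (volume.restrict (Set.Ioc (0 : ℝ) 1)) :=
    ⟨by simp⟩
  have hmem := (convex_convexHull ℝ _).integral_mem hclosed (Filter.Eventually.of_forall hf)
    (Integrable.of_eval hint)
  convert hmem
  ext k
  rw [eval_integral hint, integral_indicator_one measurableSet_Iic,
    measureReal_restrict_apply measurableSet_Iic, Set.inter_comm,
    Set.Ioc_inter_Iic, min_eq_right (h1 k), Real.volume_real_Ioc_of_le (h0 k), sub_zero]

theorem sum_mul_nonneg_of_antitone [Fintype ι] [Preorder ι] {c z : ι → ℝ} (hc : Antitone c)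
    (hz : ∀ T : Finset ι, IsLowerSet (T : Set ι) → 0 ≤ ∑ k ∈ T, z k) (hsum : ∑ k, z k = 0) :
    0 ≤ ∑ k, c k * z k := by
  obtain ⟨B, hB, hcB⟩ : ∃ B > 0, ∀ k, |c k| ≤ B :=
    ⟨1 + ∑ k, |c k|, by positivity, fun k => by
      linarith [Finset.single_le_sum (fun i _ => abs_nonneg (c i)) (Finset.mem_univ k)]⟩
  let l : ι → ℝ := fun k => (c k + B) / (2 * B)
  have hl : l ∈ convexHull ℝ _ := mem_convexHull_indicator_of_antitone
    (fun i j hij => by simp only [l]; gcongr; exact hc hij)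
    (fun k => div_nonneg (by linarith [neg_abs_le (c k), hcB k]) (by positivity))
    (fun k => div_le_one_of_le₀ (by linarith [le_abs_self (c k), hcB k]) (by positivity))
  have hhalf : l ∈ {v : ι → ℝ | 0 ≤ z ⬝ᵥ v} := by
    refine convexHull_min ?_ (convex_halfSpace_ge (dotProductBilin ℝ ℝ z).isLinear 0) hl
    rintro _ ⟨T, hT, rfl⟩
    classical
    simpa [dotProduct, Set.indicator_apply] using hz T hT
  have hscale : ∑ k, c k * z k = 2 * B * (z ⬝ᵥ l) := by
    have (k : ι) : c k * z k = 2 * B * (z k * l k) - B * z k := by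
      simp only [l]; field_simp; ring
    simp only [this, Finset.sum_sub_distrib, ← Finset.mul_sum, hsum, mul_zero, sub_zero, dotProduct]
  rw [hscale]
  exact mul_nonneg (by positivity) hhalf

/-- Majorization of `x` by a vector `y` that is meant to be antitone: the sum of `y` over an
initial segment `T` of the indices is then the sum of its `#T` largest entries. -/
structure IsMajorizedBy [Fintype ι] [Preorder ι] (x y : ι → ℝ) : Prop where
  sum_le : ∀ A T : Finset ι, IsLowerSet (T : Set ι) → A.card = T.card →
    ∑ i ∈ A, x i ≤ ∑ k ∈ T, y k
  sum_eq : ∑ i, x i = ∑ k, y k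

namespace IsMajorizedBy

variable {d : ℕ} {x y : Fin d → ℝ}

-- A functional `c` separating `x` from the hull contradicts the Abel summation of `c`, sorted in
-- decreasing order, against `y - x`.
theorem mem_convexHull_perm (h : IsMajorizedBy x y) :
    x ∈ convexHull ℝ (Set.range fun π : Equiv.Perm (Fin d) => y ∘ π) := by
  by_contra hx
  obtain ⟨f, u, hu, hfx⟩ := geometric_hahn_banach_closed_point (convex_convexHull ℝ _)
    ((Set.finite_range fun π : Equiv.Perm (Fin d) => y ∘ π).isCompact_convexHull
      (𝕜 := ℝ)).isClosed hx
  let c : Fin d → ℝ := fun i => f (Pi.single i 1)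
  have hf (v : Fin d → ℝ) : f v = ∑ i, c i * v i := by
    conv_lhs => rw [← Finset.univ_sum_single v, map_sum]
    refine Finset.sum_congr rfl fun i _ => ?_
    rw [← mul_one (v i), ← smul_eq_mul (v i), Pi.single_smul, map_smul, smul_eq_mul, smul_eq_mul,
      mul_one, mul_comm]
  set s := Tuple.sort (-c)
  have hanti : Antitone (c ∘ s) := fun i j hij => by simpa using Tuple.monotone_sort (-c) hij
  have hfy : ∑ k, c (s k) * y k < u := by
    have := hu (y ∘ s.symm) (subset_convexHull ℝ _ ⟨s.symm, rfl⟩)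
    rw [hf, ← Equiv.sum_comp s] at this
    simpa using this
  have hfx : u < ∑ k, c (s k) * x (s k) := by rwa [hf, ← Equiv.sum_comp s] at hfx
  have habel : 0 ≤ ∑ k, (c ∘ s) k * (y k - x (s k)) := by
    refine sum_mul_nonneg_of_antitone hanti (fun T hT => ?_) ?_
    · rw [Finset.sum_sub_distrib, sub_nonneg]
      simpa using h.sum_le (T.map s.toEmbedding) T hT (Finset.card_map _)
    · rw [Finset.sum_sub_distrib, Equiv.sum_comp s x, h.sum_eq, sub_self]
  simp only [mul_sub, Finset.sum_sub_distrib, Function.comp_apply] at habel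
  linarith

theorem mem_stdSimplex (h : IsMajorizedBy x y) (hy : y ∈ stdSimplex ℝ (Fin d)) :
    x ∈ stdSimplex ℝ (Fin d) := by
  refine convexHull_min ?_ (convex_stdSimplex ℝ _) h.mem_convexHull_perm
  rintro _ ⟨π, rfl⟩
  exact ⟨fun i => hy.1 _, (Equiv.sum_comp π y).trans hy.2⟩

theorem le_of_concaveOn_stdSimplex (h : IsMajorizedBy x y) (hy : y ∈ stdSimplex ℝ (Fin d))
    {φ : (Fin d → ℝ) → ℝ} (hφ : ConcaveOn ℝ (stdSimplex ℝ (Fin d)) φ)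
    (hsymm : ∀ (π : Equiv.Perm (Fin d)) (v : Fin d → ℝ), φ (v ∘ π) = φ v) : φ y ≤ φ x := by
  obtain ⟨_, ⟨π, rfl⟩, hπ⟩ := hφ.exists_le_of_mem_convexHull (by
      rintro _ ⟨π, rfl⟩
      exact ⟨fun i => hy.1 _, (Equiv.sum_comp π y).trans hy.2⟩) h.mem_convexHull_perm
  rwa [hsymm] at hπ

end IsMajorizedBy

end Majorization

open Matrix
open scoped Matrix.Norms.Frobenius

section Projection

variable {n : Type*} [Fintype n]

theorem sq_norm_eq_re_trace (X : Matrix n n ℂ) : ‖X‖ ^ 2 = (X * Xᴴ).trace.re := by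
  rw [frobenius_norm_def, ← Real.sqrt_eq_rpow, Real.sq_sqrt (by positivity), trace, Complex.re_sum]
  refine Finset.sum_congr rfl fun i _ => ?_
  rw [diag_apply, mul_apply, Complex.re_sum]
  refine Finset.sum_congr rfl fun j _ => ?_
  rw [conjTranspose_apply, Complex.star_def, Complex.mul_conj, Complex.ofReal_re,
    Complex.normSq_eq_norm_sq, Real.rpow_two]

theorem re_trace_mul_conjTranspose_add_le (X Y : Matrix n n ℂ) :
    (X * Yᴴ + Y * Xᴴ).trace.re ≤ ‖X‖ ^ 2 + ‖Y‖ ^ 2 := by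
  have h := sq_nonneg ‖X - Y‖
  rw [sq_norm_eq_re_trace, conjTranspose_sub, sub_mul, mul_sub, mul_sub] at h
  simp only [trace_sub, trace_add, Complex.sub_re, Complex.add_re, sq_norm_eq_re_trace] at h ⊢
  linarith

theorem two_mul_re_trace_sub_le {P Q : Matrix n n ℂ} (hP : IsStarProjection P)
    (hQ : IsStarProjection Q) :
    2 * (P * Q).trace.re - (P * Q * P * Q).trace.re ≤ P.trace.re := by
  have hPQP : (P * Q * P).trace = (P * Q).trace := by
    rw [trace_mul_cycle, hP.isIdempotentElem.eq]
  have hsq : ((P - P * Q * P) * (P - P * Q * P)ᴴ).trace =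
      P.trace - 2 * (P * Q).trace + (P * Q * P * Q).trace := by
    have hPh : Pᴴ = P := hP.isSelfAdjoint
    have hQh : Qᴴ = Q := hQ.isSelfAdjoint
    have hcycle : (P * Q * P * Q * P).trace = (P * Q * P * Q).trace := by
      rw [trace_mul_comm, ← Matrix.mul_assoc, ← Matrix.mul_assoc, ← Matrix.mul_assoc,
        hP.isIdempotentElem.eq]
    have hPP (M : Matrix n n ℂ) : M * P * P = M * P := by
      rw [Matrix.mul_assoc, hP.isIdempotentElem.eq]
    simp only [conjTranspose_sub, conjTranspose_mul, hPh, hQh, Matrix.sub_mul, Matrix.mul_sub,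
      ← Matrix.mul_assoc, hP.isIdempotentElem.eq, hPP, trace_sub, hPQP, hcycle]
    ring
  have h := sq_nonneg ‖P - P * Q * P‖
  rw [sq_norm_eq_re_trace, hsq] at h
  simp only [Complex.add_re, Complex.sub_re, Complex.mul_re, Complex.re_ofNat, Complex.im_ofNat,
    zero_mul, sub_zero] at h
  linarith

variable [DecidableEq n]

/-- The compression `Tr (P M)` plus the squared Frobenius norm of the off-diagonal block
`P M (1 - P)`. For a projection `P` the block pays for the commutator term of `boxplus`. -/
noncomputable def blockFunctional (P M : Matrix n n ℂ) : ℝ :=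
  (P * M).trace.re + ‖P * M * (1 - P)‖ ^ 2

theorem re_trace_mul_le_blockFunctional (P M : Matrix n n ℂ) :
    (P * M).trace.re ≤ blockFunctional P M :=
  le_add_of_nonneg_right (sq_nonneg _)

theorem convexOn_blockFunctional (P : Matrix n n ℂ) :
    ConvexOn ℝ Set.univ (blockFunctional P) := by
  have hlin : ConvexOn ℝ Set.univ fun M : Matrix n n ℂ => (P * M).trace.re :=
    (Complex.reLm ∘ₗ traceLinearMap n ℝ ℂ ∘ₗ LinearMap.mulLeft ℝ P).convexOn convex_univ
  have hsq : ConvexOn ℝ Set.univ fun M : Matrix n n ℂ => ‖P * M * (1 - P)‖ ^ 2 :=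
    ((convexOn_norm convex_univ).pow (fun _ _ => norm_nonneg _) 2).comp_linearMap
      (LinearMap.mulRight ℝ (1 - P) ∘ₗ LinearMap.mulLeft ℝ P)
  exact hlin.add hsq

variable {P : Matrix n n ℂ}

theorem trace_mul_conjTranspose_of_isStarProjection (hP : IsStarProjection P) (M : Matrix n n ℂ)
    {N : Matrix n n ℂ} (hN : N.IsHermitian) :
    (P * M * (1 - P) * (P * N * (1 - P))ᴴ).trace = (P * M * (1 - P) * N).trace := by
  have hPh : Pᴴ = P := hP.isSelfAdjoint
  have hQ : (1 - P) * (1 - P) = 1 - P := hP.isIdempotentElem.one_sub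
  rw [conjTranspose_mul, conjTranspose_mul, conjTranspose_sub, conjTranspose_one, hPh, hN.eq,
    Matrix.mul_assoc, ← Matrix.mul_assoc (1 - P), hQ, ← Matrix.mul_assoc, ← Matrix.mul_assoc,
    trace_mul_comm, ← Matrix.mul_assoc, ← Matrix.mul_assoc, ← Matrix.mul_assoc,
    hP.isIdempotentElem.eq]

theorem re_trace_mul_commutator_le (hP : IsStarProjection P) {M N : Matrix n n ℂ}
    (hM : M.IsHermitian) (hN : N.IsHermitian) :
    (P * (-Complex.I • (M * N - N * M))).trace.re ≤
      ‖P * M * (1 - P)‖ ^ 2 + ‖P * N * (1 - P)‖ ^ 2 := by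
  have h := re_trace_mul_conjTranspose_add_le (P * M * (1 - P))
    (Complex.I • (P * N * (1 - P)))
  rw [norm_smul, Complex.norm_I, one_mul] at h
  refine le_of_eq_of_le ?_ h
  have hPP : (P * M * P * N).trace = (P * N * P * M).trace := by
    rw [Matrix.mul_assoc, trace_mul_comm, ← Matrix.mul_assoc]
  congr 1
  rw [conjTranspose_smul, Matrix.mul_smul, Matrix.mul_smul, Matrix.smul_mul, trace_add, trace_smul,
    trace_smul, trace_smul,
    trace_mul_conjTranspose_of_isStarProjection hP _ hN,
    trace_mul_conjTranspose_of_isStarProjection hP _ hM]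
  simp only [Matrix.mul_sub, Matrix.sub_mul, trace_sub, Matrix.mul_one, hPP, smul_eq_mul,
    Complex.star_def, Complex.conj_I, ← Matrix.mul_assoc]
  ring

theorem blockFunctional_le_re_trace {Q : Matrix n n ℂ} (hP : IsStarProjection P)
    (hQ : IsStarProjection Q) : blockFunctional P Q ≤ min P.trace.re Q.trace.re := by
  have hval : blockFunctional P Q = 2 * (P * Q).trace.re - (P * Q * P * Q).trace.re := by
    rw [blockFunctional, sq_norm_eq_re_trace,
      trace_mul_conjTranspose_of_isStarProjection hP _ hQ.isSelfAdjoint, Matrix.mul_sub,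
      Matrix.mul_one, Matrix.sub_mul, Matrix.mul_assoc P, hQ.isIdempotentElem.eq, trace_sub,
      Complex.sub_re]
    ring
  have hcomm : 2 * (P * Q).trace.re - (P * Q * P * Q).trace.re =
      2 * (Q * P).trace.re - (Q * P * Q * P).trace.re := by
    rw [trace_mul_comm P Q, trace_mul_comm (P * Q * P) Q, ← Matrix.mul_assoc, ← Matrix.mul_assoc]
  exact le_min (hval.trans_le (two_mul_re_trace_sub_le hP hQ))
    ((hval.trans hcomm).trans_le (two_mul_re_trace_sub_le hQ hP))

theorem isStarProjection_conj_diagonal_indicator {U : Matrix n n ℂ} (hU : Uᴴ * U = 1)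
    (S : Set n) :
    IsStarProjection (U * diagonal (fun k => ((S.indicator 1 k : ℝ) : ℂ)) * Uᴴ) := by
  set D : Matrix n n ℂ := diagonal fun k => ((S.indicator 1 k : ℝ) : ℂ) with hD
  have hDD : D * D = D := by
    rw [hD, diagonal_mul_diagonal]
    congr! 2 with k
    by_cases hk : k ∈ S <;> simp [hk]
  refine ⟨?_, ?_⟩
  · calc U * D * Uᴴ * (U * D * Uᴴ) = U * D * (Uᴴ * U) * D * Uᴴ := by simp only [Matrix.mul_assoc]
      _ = U * D * Uᴴ := by rw [hU, Matrix.mul_one, Matrix.mul_assoc U, hDD]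
  · refine isHermitian_mul_mul_conjTranspose U (isHermitian_diagonal_iff.2 fun k => ?_)
    exact Complex.conj_ofReal _

theorem trace_conj_diagonal_ofReal {U : Matrix n n ℂ} (hU : Uᴴ * U = 1) (l : n → ℝ) :
    (U * diagonal (fun k => (l k : ℂ)) * Uᴴ).trace = ((∑ k, l k : ℝ) : ℂ) := by
  rw [trace_mul_cycle, hU, Matrix.one_mul, trace_diagonal, Complex.ofReal_sum]

end Projection

-- Both sides are convex in the eigenvalue vector `l`, so it suffices to treat the indicator of an
-- initial segment `S`; there `M` is a projection of rank `#S`, and `min #S #T = #(S ∩ T)`.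
theorem blockFunctional_conj_diagonal_le {n : Type*} [Fintype n] [LinearOrder n]
    {U : Matrix n n ℂ} (hU : Uᴴ * U = 1) {l : n → ℝ} (hl : Antitone l)
    (h0 : ∀ k, 0 ≤ l k) (h1 : ∀ k, l k ≤ 1) {P : Matrix n n ℂ} (hP : IsStarProjection P)
    {T : Finset n} (hT : IsLowerSet (T : Set n)) (htr : P.trace = T.card) :
    blockFunctional P (U * diagonal (fun k => (l k : ℂ)) * Uᴴ) ≤ ∑ k ∈ T, l k := by
  let L : (n → ℝ) →ₗ[ℝ] Matrix n n ℂ := LinearMap.mulRight ℝ Uᴴ ∘ₗ LinearMap.mulLeft ℝ U ∘ₗ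
    diagonalLinearMap n ℝ ℂ ∘ₗ Complex.ofRealCLM.toLinearMap.compLeft n
  have hsum : ConcaveOn ℝ Set.univ fun l : n → ℝ => ∑ k ∈ T, l k :=
    ⟨convex_univ, fun u _ v _ a b _ _ _ => by simp [Finset.sum_add_distrib, Finset.mul_sum]⟩
  have hconv : ConvexOn ℝ Set.univ fun l : n → ℝ => blockFunctional P (L l) - ∑ k ∈ T, l k :=
    ((convexOn_blockFunctional P).comp_linearMap L).sub hsum
  refine sub_nonpos.1 (convexHull_min ?_ (hconv.convex_le 0)
    (mem_convexHull_indicator_of_antitone hl h0 h1)).2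
  rintro _ ⟨S, hS, rfl⟩
  refine ⟨Set.mem_univ _, sub_nonpos.2 <| (blockFunctional_le_re_trace hP
    (isStarProjection_conj_diagonal_indicator hU S)).trans ?_⟩
  have hcard (A : Finset n) : ∑ k ∈ A, (S : Set n).indicator (1 : n → ℝ) k = (A ∩ S).card := by
    simp [Set.indicator_apply]
  rw [trace_conj_diagonal_ofReal hU, htr, hcard, hcard, Finset.univ_inter, Complex.natCast_re,
    Complex.ofReal_re]
  rcases hT.total hS with h | h
  · rw [Finset.inter_eq_left.2 (Finset.coe_subset.1 h)]
    exact min_le_left _ _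
  · rw [Finset.inter_eq_right.2 (Finset.coe_subset.1 h)]
    exact min_le_right _ _

section Spectrum

variable {d : ℕ}

theorem exists_spectrumVec_eq_comp {A : Matrix (Fin d) (Fin d) ℂ} (hA : A.IsHermitian) :
    ∃ e : Equiv.Perm (Fin d), spectrumVec A = hA.eigenvalues ∘ e := by
  refine ⟨(finCongr (Fintype.card_fin d).symm).trans
    (Fintype.equivOfCardEq (Fintype.card_fin _)), ?_⟩
  ext i
  simp [spectrumVec, hA, IsHermitian.eigenvalues]

theorem spectrumVec_antitone (A : Matrix (Fin d) (Fin d) ℂ) : Antitone (spectrumVec A) := by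
  unfold spectrumVec
  split_ifs with hA
  · exact fun i j hij => hA.eigenvalues₀_antitone hij
  · exact antitone_const

theorem exists_spectral_decomposition {A : Matrix (Fin d) (Fin d) ℂ} (hA : A.IsHermitian) :
    ∃ U : Matrix (Fin d) (Fin d) ℂ, Uᴴ * U = 1 ∧
      A = U * diagonal (fun k => (spectrumVec A k : ℂ)) * Uᴴ := by
  obtain ⟨e, he⟩ := exists_spectrumVec_eq_comp hA
  let V : Matrix (Fin d) (Fin d) ℂ := hA.eigenvectorUnitary
  have hV : V * Vᴴ = 1 := Unitary.coe_mul_star_self hA.eigenvectorUnitary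
  have hAV : A = V * diagonal (fun k => (hA.eigenvalues k : ℂ)) * Vᴴ :=
    hA.spectral_theorem.trans (Unitary.conjStarAlgAut_apply _ _)
  have hD : diagonal (fun k => (spectrumVec A k : ℂ)) =
      (diagonal fun k => (hA.eigenvalues k : ℂ)).submatrix e e := by
    rw [submatrix_diagonal_equiv, he]
    rfl
  refine ⟨V.submatrix id e, mul_eq_one_comm.1 ?_, ?_⟩
  · rw [conjTranspose_submatrix, submatrix_mul_equiv, hV, submatrix_id_id]
  · rw [hD, conjTranspose_submatrix, submatrix_mul_equiv, submatrix_mul_equiv, submatrix_id_id]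
    exact hAV

theorem trace_eq_sum_spectrumVec {A : Matrix (Fin d) (Fin d) ℂ} (hA : A.IsHermitian) :
    A.trace = ((∑ i, spectrumVec A i : ℝ) : ℂ) := by
  obtain ⟨U, hU, hAU⟩ := exists_spectral_decomposition hA
  conv_lhs => rw [hAU, trace_conj_diagonal_ofReal hU]

theorem mem_densityMatrices_iff {ρ : Matrix (Fin d) (Fin d) ℂ} :
    ρ ∈ densityMatrices d ↔ ρ.IsHermitian ∧ spectrumVec ρ ∈ stdSimplex ℝ (Fin d) := by
  have hpos (hρ : ρ.IsHermitian) : ρ.PosSemidef ↔ ∀ i, 0 ≤ spectrumVec ρ i := by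
    obtain ⟨e, he⟩ := exists_spectrumVec_eq_comp hρ
    rw [hρ.posSemidef_iff_eigenvalues_nonneg, he]
    exact e.forall_congr_right.symm
  have htr (hρ : ρ.IsHermitian) : ρ.trace = 1 ↔ ∑ i, spectrumVec ρ i = 1 := by
    rw [trace_eq_sum_spectrumVec hρ]
    exact_mod_cast Iff.rfl
  constructor
  · rintro ⟨h, h1⟩
    exact ⟨h.isHermitian, (hpos h.isHermitian).1 h, (htr h.isHermitian).1 h1⟩
  · rintro ⟨h, h0, h1⟩
    exact ⟨(hpos h).2 h0, (htr h).2 h1⟩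

theorem isMajorizedBy_spectrumVec {τ : Matrix (Fin d) (Fin d) ℂ} (hτ : τ.IsHermitian)
    {y : Fin d → ℝ}
    (hle : ∀ (P : Matrix (Fin d) (Fin d) ℂ) (T : Finset (Fin d)), IsStarProjection P →
      IsLowerSet (T : Set (Fin d)) → P.trace = T.card → (P * τ).trace.re ≤ ∑ k ∈ T, y k)
    (hsum : τ.trace = ((∑ k, y k : ℝ) : ℂ)) : IsMajorizedBy (spectrumVec τ) y := by
  refine ⟨fun A T hT hAT => ?_, ?_⟩
  · obtain ⟨U, hU, hτU⟩ := exists_spectral_decomposition hτ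
    set E : Fin d → ℝ := (A : Set (Fin d)).indicator 1 with hE
    set l := spectrumVec τ
    have hPτ : U * diagonal (fun k => (E k : ℂ)) * Uᴴ * τ =
        U * diagonal (fun k => ((E k * l k : ℝ) : ℂ)) * Uᴴ := by
      rw [hτU]
      calc
        _ = U * diagonal (fun k => (E k : ℂ)) * (Uᴴ * U) * diagonal (fun k => (l k : ℂ)) * Uᴴ := by
            simp only [Matrix.mul_assoc]
        _ = _ := by
            rw [hU, Matrix.mul_one, Matrix.mul_assoc U, diagonal_mul_diagonal]
            simp only [Complex.ofReal_mul]
    have h := hle _ T (isStarProjection_conj_diagonal_indicator hU A) hT (by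
      rw [trace_conj_diagonal_ofReal hU, ← hAT]
      simp [Set.indicator_apply])
    rw [hPτ, trace_conj_diagonal_ofReal hU, Complex.ofReal_re] at h
    simpa [hE, Set.indicator_apply] using h
  · rw [trace_eq_sum_spectrumVec hτ] at hsum
    exact_mod_cast hsum

theorem isMajorizedBy_of_re_trace_le_blockFunctional {ρ σ τ : Matrix (Fin d) (Fin d) ℂ}
    (hρ : ρ ∈ densityMatrices d) (hσ : σ ∈ densityMatrices d) (hτ : τ.IsHermitian)
    (htr : τ.trace = 1) {a b : ℝ} (ha : 0 ≤ a) (hb : 0 ≤ b) (hab : a + b = 1)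
    (h : ∀ P, IsStarProjection P →
      (P * τ).trace.re ≤ a * blockFunctional P ρ + b * blockFunctional P σ) :
    IsMajorizedBy (spectrumVec τ) (a • spectrumVec ρ + b • spectrumVec σ) := by
  have hblock {ρ P : Matrix (Fin d) (Fin d) ℂ} {T : Finset (Fin d)} (hρ : ρ ∈ densityMatrices d)
      (hP : IsStarProjection P) (hT : IsLowerSet (T : Set (Fin d))) (hPT : P.trace = T.card) :
      blockFunctional P ρ ≤ ∑ k ∈ T, spectrumVec ρ k := by
    obtain ⟨hρh, hmem⟩ := mem_densityMatrices_iff.1 hρ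
    obtain ⟨U, hU, hρU⟩ := exists_spectral_decomposition hρh
    have hle := blockFunctional_conj_diagonal_le hU (spectrumVec_antitone ρ) hmem.1
      (fun k => (mem_Icc_of_mem_stdSimplex hmem k).2) hP hT hPT
    rwa [← hρU] at hle
  refine isMajorizedBy_spectrumVec hτ (fun P T hP hT hPT => (h P hP).trans ?_) ?_
  · simp only [Pi.add_apply, Pi.smul_apply, smul_eq_mul, Finset.sum_add_distrib, ← Finset.mul_sum]
    gcongr
    · exact hblock hρ hP hT hPT
    · exact hblock hσ hP hT hPT
  · rw [(convex_stdSimplex ℝ (Fin d) (mem_densityMatrices_iff.1 hρ).2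
      (mem_densityMatrices_iff.1 hσ).2 ha hb hab).2, htr, Complex.ofReal_one]

theorem isMajorizedBy_spectrumVec_convexCombination {ρ σ : Matrix (Fin d) (Fin d) ℂ}
    (hρ : ρ ∈ densityMatrices d) (hσ : σ ∈ densityMatrices d) {a b : ℝ} (ha : 0 ≤ a)
    (hb : 0 ≤ b) (hab : a + b = 1) :
    IsMajorizedBy (spectrumVec (a • ρ + b • σ)) (a • spectrumVec ρ + b • spectrumVec σ) := by
  refine isMajorizedBy_of_re_trace_le_blockFunctional hρ hσ
    ((hρ.1.smul ha).add (hσ.1.smul hb)).isHermitian ?_ ha hb hab fun P _ => ?_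
  · rw [trace_add, trace_smul, trace_smul, hρ.2, hσ.2, ← add_smul, hab, one_smul]
  · rw [Matrix.mul_add, Matrix.mul_smul, Matrix.mul_smul, trace_add, trace_smul, trace_smul,
      Complex.add_re, Complex.smul_re, Complex.smul_re, smul_eq_mul, smul_eq_mul]
    gcongr <;> exact re_trace_mul_le_blockFunctional _ _

theorem isHermitian_boxplus {ρ σ : Matrix (Fin d) (Fin d) ℂ} (hρ : ρ.IsHermitian)
    (hσ : σ.IsHermitian) (a : ℝ) : (boxplus a ρ σ).IsHermitian := by
  simp only [IsHermitian, boxplus, conjTranspose_sub, conjTranspose_add, conjTranspose_smul,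
    conjTranspose_mul, hρ.eq, hσ.eq, star_trivial, star_mul', Complex.star_def, Complex.conj_ofReal,
    Complex.conj_I, mul_neg, neg_smul, ← smul_neg, neg_sub]

theorem trace_boxplus (ρ σ : Matrix (Fin d) (Fin d) ℂ) (a : ℝ) :
    (boxplus a ρ σ).trace = a • ρ.trace + (1 - a) • σ.trace := by
  simp [boxplus, trace_mul_comm ρ σ, trace_smul]

theorem isMajorizedBy_spectrumVec_boxplus {ρ σ : Matrix (Fin d) (Fin d) ℂ}
    (hρ : ρ ∈ densityMatrices d) (hσ : σ ∈ densityMatrices d) {a : ℝ}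
    (ha : a ∈ Set.Icc (0 : ℝ) 1) :
    IsMajorizedBy (spectrumVec (boxplus a ρ σ)) (a • spectrumVec ρ + (1 - a) • spectrumVec σ) := by
  have hρh := hρ.1.isHermitian
  have hσh := hσ.1.isHermitian
  have ha1 : 0 ≤ 1 - a := sub_nonneg.2 ha.2
  refine isMajorizedBy_of_re_trace_le_blockFunctional hρ hσ (isHermitian_boxplus hρh hσh a) ?_
    ha.1 ha1 (add_sub_cancel a 1) fun P hP => ?_
  · rw [trace_boxplus, hρ.2, hσ.2, ← add_smul, add_sub_cancel, one_smul]
  have hbox : boxplus a ρ σ = a • ρ + (1 - a) • σ +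
      -Complex.I • ((√a • ρ) * (√(1 - a) • σ) - (√(1 - a) • σ) * (√a • ρ)) := by
    rw [boxplus, Real.sqrt_mul ha.1, sub_eq_add_neg, ← neg_smul]
    congr 1
    ext i j
    simp only [Complex.ofReal_mul, Matrix.smul_apply, Matrix.sub_apply, smul_eq_mul, neg_mul,
      Algebra.mul_smul_comm, Algebra.smul_mul_assoc, Complex.real_smul, neg_inj]
    ring
  have hnorm {x : ℝ} (hx : 0 ≤ x) (M : Matrix (Fin d) (Fin d) ℂ) :
      ‖P * (√x • M) * (1 - P)‖ ^ 2 = x * ‖P * M * (1 - P)‖ ^ 2 := by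
    rw [Matrix.mul_smul, Matrix.smul_mul, norm_smul, mul_pow, Real.norm_eq_abs, sq_abs,
      Real.sq_sqrt hx]
  have hcomm := re_trace_mul_commutator_le hP (hρh.smul (IsSelfAdjoint.all √a))
    (hσh.smul (IsSelfAdjoint.all √(1 - a)))
  rw [hnorm ha.1, hnorm ha1] at hcomm
  rw [hbox, Matrix.mul_add, Matrix.mul_add, Matrix.mul_smul, Matrix.mul_smul, trace_add, trace_add,
    trace_smul, trace_smul]
  simp only [Complex.add_re, Complex.smul_re, smul_eq_mul, blockFunctional] at hcomm ⊢
  linarith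

theorem boxplus_mem_densityMatrices {ρ σ : Matrix (Fin d) (Fin d) ℂ}
    (hρ : ρ ∈ densityMatrices d) (hσ : σ ∈ densityMatrices d) {a : ℝ}
    (ha : a ∈ Set.Icc (0 : ℝ) 1) : boxplus a ρ σ ∈ densityMatrices d :=
  mem_densityMatrices_iff.2 ⟨isHermitian_boxplus hρ.1.isHermitian hσ.1.isHermitian a,
    (isMajorizedBy_spectrumVec_boxplus hρ hσ ha).mem_stdSimplex <|
      convex_stdSimplex ℝ (Fin d) (mem_densityMatrices_iff.1 hρ).2 (mem_densityMatrices_iff.1 hσ).2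
        ha.1 (sub_nonneg.2 ha.2) (add_sub_cancel a 1)⟩

theorem convex_densityMatrices (d : ℕ) : Convex ℝ (densityMatrices d) := by
  intro ρ hρ σ hσ a b ha hb hab
  refine ⟨(hρ.1.smul ha).add (hσ.1.smul hb), ?_⟩
  rw [trace_add, trace_smul, trace_smul, hρ.2, hσ.2, ← add_smul, hab, one_smul]

theorem mem_classF_of_concaveOn_stdSimplex {f : Matrix (Fin d) (Fin d) ℂ → ℝ}
    {φ : (Fin d → ℝ) → ℝ} (hφ : ConcaveOn ℝ (stdSimplex ℝ (Fin d)) φ)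
    (hsymm : ∀ (π : Equiv.Perm (Fin d)) (v : Fin d → ℝ), φ (v ∘ π) = φ v)
    (hfφ : ∀ ρ ∈ densityMatrices d, f ρ = φ (spectrumVec ρ)) : f ∈ classF d := by
  refine ⟨⟨convex_densityMatrices d, fun ρ hρ σ hσ a b ha hb hab => ?_⟩, φ, hsymm, hfφ⟩
  rw [hfφ ρ hρ, hfφ σ hσ, hfφ _ (convex_densityMatrices d hρ hσ ha hb hab)]
  have hρs := (mem_densityMatrices_iff.1 hρ).2
  have hσs := (mem_densityMatrices_iff.1 hσ).2
  exact (hφ.2 hρs hσs ha hb hab).trans <|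
    (isMajorizedBy_spectrumVec_convexCombination hρ hσ ha hb hab).le_of_concaveOn_stdSimplex
      (convex_stdSimplex ℝ (Fin d) hρs hσs ha hb hab) hφ hsymm

theorem exists_perm_of_map_univ_eq {α : Type*} [LinearOrder α] {f g : Fin d → α}
    (h : Finset.univ.val.map f = Finset.univ.val.map g) :
    ∃ π : Equiv.Perm (Fin d), f = g ∘ π := by
  have hp : (List.ofFn f).Perm (List.ofFn g) := by
    rw [← Multiset.coe_eq_coe, ← Fin.univ_val_map, ← Fin.univ_val_map, h]
  have hs : f ∘ Tuple.sort f = g ∘ Tuple.sort g :=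
    List.ofFn_injective <| List.Perm.eq_of_sortedLE
      (Tuple.monotone_sort f).sortedLE_ofFn (Tuple.monotone_sort g).sortedLE_ofFn
      (((Equiv.Perm.ofFn_comp_perm _ f).trans hp).trans (Equiv.Perm.ofFn_comp_perm _ g).symm)
  refine ⟨(Tuple.sort f).symm.trans (Tuple.sort g), ?_⟩
  ext i
  simpa using congrFun hs ((Tuple.sort f).symm i)

theorem exists_spectrumVec_diagonal (v : Fin d → ℝ) :
    ∃ π : Equiv.Perm (Fin d), spectrumVec (diagonal fun k => (v k : ℂ)) = v ∘ π := by
  have hA : (diagonal fun k => (v k : ℂ)).IsHermitian :=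
    isHermitian_diagonal_iff.2 fun k => Complex.conj_ofReal (v k)
  obtain ⟨e, he⟩ := exists_spectrumVec_eq_comp hA
  have hroots := hA.roots_charpoly_eq_eigenvalues
  have hdiag : (diagonal fun k => (v k : ℂ)).charpoly.roots =
      Finset.univ.val.map fun k => (v k : ℂ) := by
    rw [charpoly_diagonal, ← Polynomial.roots_multiset_prod_X_sub_C (Multiset.map _ _),
      Multiset.map_map]
    rfl
  obtain ⟨π, hπ⟩ := exists_perm_of_map_univ_eq (f := hA.eigenvalues) (g := v) <| by
    have h := congrArg (Multiset.map Complex.re) (hroots.symm.trans hdiag)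
    rwa [Multiset.map_map, Multiset.map_map] at h
  exact ⟨e.trans π, by rw [he, hπ]; rfl⟩

theorem concaveOn_stdSimplex_of_concaveOn_densityMatrices
    {f : Matrix (Fin d) (Fin d) ℂ → ℝ} {φ : (Fin d → ℝ) → ℝ}
    (hf : ConcaveOn ℝ (densityMatrices d) f)
    (hsymm : ∀ (π : Equiv.Perm (Fin d)) (v : Fin d → ℝ), φ (v ∘ π) = φ v)
    (hfφ : ∀ ρ ∈ densityMatrices d, f ρ = φ (spectrumVec ρ)) :
    ConcaveOn ℝ (stdSimplex ℝ (Fin d)) φ := by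
  let D : (Fin d → ℝ) →ₗ[ℝ] Matrix (Fin d) (Fin d) ℂ :=
    diagonalLinearMap (Fin d) ℝ ℂ ∘ₗ Complex.ofRealCLM.toLinearMap.compLeft (Fin d)
  have hD : ∀ v ∈ stdSimplex ℝ (Fin d), D v ∈ densityMatrices d ∧ f (D v) = φ v := by
    intro v hv
    obtain ⟨π, hπ⟩ := exists_spectrumVec_diagonal v
    have hmem : D v ∈ densityMatrices d := by
      refine ⟨PosSemidef.diagonal fun k => Complex.zero_le_real.2 (hv.1 k), ?_⟩
      change (diagonal fun k => (v k : ℂ)).trace = 1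
      rw [trace_diagonal, ← Complex.ofReal_sum, hv.2, Complex.ofReal_one]
    exact ⟨hmem, (hfφ _ hmem).trans ((congrArg φ hπ).trans (hsymm π v))⟩
  exact ((hf.comp_linearMap D).subset (fun v hv => (hD v hv).1)
    (convex_stdSimplex ℝ (Fin d))).congr fun v hv => (hD v hv).2

theorem le_boxplus {f : Matrix (Fin d) (Fin d) ℂ → ℝ} (hf : f ∈ classF d)
    {ρ σ : Matrix (Fin d) (Fin d) ℂ} (hρ : ρ ∈ densityMatrices d) (hσ : σ ∈ densityMatrices d)
    {a : ℝ} (ha : a ∈ Set.Icc (0 : ℝ) 1) :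
    a * f ρ + (1 - a) * f σ ≤ f (boxplus a ρ σ) := by
  obtain ⟨hconc, φ, hsymm, hfφ⟩ := hf
  have hφ := concaveOn_stdSimplex_of_concaveOn_densityMatrices hconc hsymm hfφ
  have hρs := (mem_densityMatrices_iff.1 hρ).2
  have hσs := (mem_densityMatrices_iff.1 hσ).2
  have ha1 : 0 ≤ 1 - a := sub_nonneg.2 ha.2
  have hab : a + (1 - a) = 1 := add_sub_cancel a 1
  rw [hfφ _ hρ, hfφ _ hσ, hfφ _ (boxplus_mem_densityMatrices hρ hσ ha)]
  exact (hφ.2 hρs hσs ha.1 ha1 hab).trans <|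
    (isMajorizedBy_spectrumVec_boxplus hρ hσ ha).le_of_concaveOn_stdSimplex
      (convex_stdSimplex ℝ (Fin d) hρs hσs ha.1 ha1 hab) hφ hsymm

end Spectrum

section Entropy

theorem concaveOn_sum_apply {ι : Type*} [Fintype ι] {s : Set ℝ} {g : ℝ → ℝ}
    (hg : ConcaveOn ℝ s g) :
    ConcaveOn ℝ (Set.univ.pi fun _ : ι => s) fun v => ∑ i, g (v i) := by
  refine ⟨convex_pi fun _ _ => hg.1, fun v hv w hw a b ha hb hab => ?_⟩
  simp only [smul_eq_mul, Finset.mul_sum, ← Finset.sum_add_distrib]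
  exact Finset.sum_le_sum fun i _ => hg.2 (hv i trivial) (hw i trivial) ha hb hab

theorem concaveOn_log_of_pos {E : Type*} [AddCommGroup E] [Module ℝ E] {s : Set E} {f : E → ℝ}
    (hf : ConcaveOn ℝ s f) (hpos : ∀ x ∈ s, 0 < f x) :
    ConcaveOn ℝ s fun x => Real.log (f x) := by
  refine ⟨hf.1, fun x hx y hy a b ha hb hab => ?_⟩
  have hlog := strictConcaveOn_log_Ioi.concaveOn.2 (hpos x hx) (hpos y hy) ha hb hab
  have hmid : 0 < a • f x + b • f y := convex_Ioi (0 : ℝ) (hpos x hx) (hpos y hy) ha hb hab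
  exact hlog.trans (Real.log_le_log hmid (hf.2 hx hy ha hb hab))

theorem concaveOn_ite_ne_zero_rpow {α : ℝ} (h0 : 0 ≤ α) (h1 : α ≤ 1) :
    ConcaveOn ℝ (Set.Ici 0) fun x : ℝ => if x ≠ 0 then x ^ α else 0 := by
  rcases h0.eq_or_lt with rfl | h0
  · refine ⟨convex_Ici 0, fun x hx y hy a b ha hb hab => ?_⟩
    have hx0 : 0 ≤ a * x := mul_nonneg ha hx
    have hy0 : 0 ≤ b * y := mul_nonneg hb hy
    simp only [Real.rpow_zero, smul_eq_mul, mul_ite, mul_one, mul_zero]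
    by_cases h : a * x + b * y = 0
    · obtain ⟨hax, hby⟩ := (add_eq_zero_iff_of_nonneg hx0 hy0).1 h
      grind [mul_eq_zero]
    · grind
  · refine (Real.concaveOn_rpow h0.le h1).congr fun x _ => ?_
    split_ifs with hx
    · rfl
    · exact not_not.1 hx ▸ Real.zero_rpow h0.ne'

theorem stdSimplex_subset_pi_Ici (ι : Type*) [Fintype ι] :
    stdSimplex ℝ ι ⊆ Set.univ.pi fun _ => Set.Ici 0 := fun _ hv i _ => hv.1 i

variable (d : ℕ)

theorem vonNeumannEntropy_mem_classF : vonNeumannEntropy ∈ classF d := by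
  refine mem_classF_of_concaveOn_stdSimplex
    ((concaveOn_sum_apply Real.concaveOn_negMulLog).subset (stdSimplex_subset_pi_Ici _)
      (convex_stdSimplex ℝ _))
    (fun π v => Equiv.sum_comp π fun i => Real.negMulLog (v i)) fun ρ _ => ?_
  simp only [vonNeumannEntropy, Real.negMulLog, neg_mul, Finset.sum_neg_distrib]

theorem renyiEntropy_mem_classF {α : ℝ} (hα : α ∈ Set.Ico (0 : ℝ) 1) :
    renyiEntropy α ∈ classF d := by
  have hsum := (concaveOn_sum_apply (concaveOn_ite_ne_zero_rpow hα.1 hα.2.le)).subset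
    (stdSimplex_subset_pi_Ici (Fin d)) (convex_stdSimplex ℝ _)
  have hpos : ∀ v ∈ stdSimplex ℝ (Fin d), 0 < ∑ i, if v i ≠ 0 then v i ^ α else 0 := by
    intro v hv
    obtain ⟨i, hi⟩ : ∃ i, v i ≠ 0 := by
      by_contra! h
      simpa [h] using hv.2
    refine Finset.sum_pos' (fun j _ => ?_) ⟨i, Finset.mem_univ i, ?_⟩
    · exact ite_nonneg (Real.rpow_nonneg (hv.1 j) α) le_rfl
    · rw [if_pos hi]
      exact Real.rpow_pos_of_pos ((hv.1 i).lt_of_ne' hi) α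
  refine mem_classF_of_concaveOn_stdSimplex
    ((concaveOn_log_of_pos hsum hpos).smul (one_div_nonneg.2 (sub_nonneg.2 hα.2.le)))
    (fun π v => ?_) fun ρ _ => ?_
  · simp only [Function.comp_apply, Equiv.sum_comp π fun i => if v i ≠ 0 then v i ^ α else 0]
  · rw [renyiEntropy, Finset.sum_filter, smul_eq_mul]

end Entropy

section Interpolation

open Polynomial

variable {F ι : Type*} [Field F] [DecidableEq ι] {s : Finset ι} {v : ι → F}

theorem sum_pow_card_div_prod_sub (hv : Set.InjOn v s) :
    ∑ i ∈ s, v i ^ s.card / ∏ j ∈ s.erase i, (v i - v j) = ∑ i ∈ s, v i := by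
  rcases s.eq_empty_or_nonempty with rfl | hs
  · simp
  have hdeg : (X ^ s.card - Lagrange.nodal s v).degree < (s.card : WithBot ℕ) := by
    refine (degree_sub_lt_left (by simp) (monic_X_pow _).ne_zero ?_).trans_eq (degree_X_pow _)
    rw [(monic_X_pow _).leadingCoeff, Lagrange.nodal_monic.leadingCoeff]
  have hcoeff := Lagrange.coeff_eq_sum hv hdeg
  rw [coeff_sub, coeff_X_pow, if_neg (Nat.sub_one_lt hs.card_ne_zero).ne, Lagrange.nodal_eq,
    prod_X_sub_C_coeff_card_pred _ _ hs.card_pos, sub_neg_eq_add, zero_add] at hcoeff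
  rw [hcoeff]
  refine Finset.sum_congr rfl fun i hi => ?_
  rw [eval_sub, ← Lagrange.nodal_eq, Lagrange.eval_nodal_at_node hi, sub_zero, eval_pow, eval_X]

-- Compare leading coefficients in the interpolation of `X ^ #s` at the nodes `v i` and `-t`.
theorem sum_pow_card_div_prod_sub_mul_inv_add (hv : Set.InjOn v s) {t : F}
    (ht : ∀ i ∈ s, v i + t ≠ 0) :
    ∑ i ∈ s, v i ^ s.card / (∏ j ∈ s.erase i, (v i - v j)) * (1 / (v i + t)) =
      1 - ∏ i ∈ s, t / (t + v i) := by
  let w : Option ι → F := fun o => o.elim (-t) v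
  have hw : Set.InjOn w s.insertNone := by
    rintro (_ | i) hi (_ | j) hj hij
    · rfl
    · exact absurd (add_eq_zero_iff_eq_neg.2 hij.symm) (ht j (Finset.some_mem_insertNone.1 hj))
    · exact absurd (add_eq_zero_iff_eq_neg.2 hij) (ht i (Finset.some_mem_insertNone.1 hi))
    · exact congrArg some
        (hv (Finset.some_mem_insertNone.1 hi) (Finset.some_mem_insertNone.1 hj) hij)
  have hlead := Lagrange.leadingCoeff_eq_sum hw (P := X ^ s.card) (by simp)
  have hnone : s.insertNone.erase none = s.map .some := by ext (_ | _) <;> simp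
  have hsome (i : ι) : s.insertNone.erase (some i) = (s.erase i).insertNone := by
    ext (_ | _) <;> simp
  rw [leadingCoeff_X_pow, Finset.sum_insertNone, hnone] at hlead
  simp only [hsome, Finset.prod_insertNone, Finset.prod_map, eval_pow, eval_X, w, Option.elim,
    Function.Embedding.some_apply, sub_neg_eq_add] at hlead
  rw [← Finset.prod_const, ← Finset.prod_div_distrib] at hlead
  refine eq_sub_iff_add_eq'.2 (Eq.trans ?_ hlead.symm)
  congr 1
  · refine Finset.prod_congr rfl fun i _ => ?_
    rw [← neg_add', neg_div_neg_eq]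
  · refine Finset.sum_congr rfl fun i _ => ?_
    rw [div_mul_div_comm, mul_one, mul_comm]

end Interpolation

section Subentropy

open MeasureTheory Filter

theorem hasDerivAt_log_add_sub_log_add {x t : ℝ} (hx : 0 < x) (ht : 0 ≤ t) :
    HasDerivAt (fun t => Real.log (1 + t) - Real.log (x + t)) (1 / (1 + t) - 1 / (x + t)) t := by
  have hlog {y : ℝ} (hy : 0 < y) : HasDerivAt (fun t => Real.log (y + t)) (1 / (y + t)) t :=
    ((hasDerivAt_id t).const_add y).log (add_pos_of_pos_of_nonneg hy ht).ne'
  exact (hlog one_pos).sub (hlog hx)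

theorem tendsto_log_add_sub_log_add (x : ℝ) :
    Tendsto (fun t => Real.log (1 + t) - Real.log (x + t)) atTop (𝓝 0) := by
  have hquot : Tendsto (fun t : ℝ => 1 + (1 - x) / (x + t)) atTop (𝓝 1) := by
    simpa using ((tendsto_atTop_add_const_left _ x tendsto_id).const_div_atTop (1 - x)).const_add 1
  have hlog := (Real.continuousAt_log one_ne_zero).tendsto.comp hquot
  rw [Real.log_one] at hlog
  refine hlog.congr' ?_
  filter_upwards [eventually_gt_atTop (-1), eventually_gt_atTop (-x)] with t ht1 htx
  have h1 : 1 + t ≠ 0 := by linarith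
  have hx : x + t ≠ 0 := by linarith
  rw [Function.comp_apply, ← Real.log_div h1 hx]
  congr 1
  field_simp
  ring

theorem integrableOn_inv_sub_inv {x : ℝ} (hx : 0 < x) :
    IntegrableOn (fun t => 1 / (1 + t) - 1 / (x + t)) (Set.Ioi 0) := by
  have hderiv (t : ℝ) (ht : t ∈ Set.Ici 0) := hasDerivAt_log_add_sub_log_add hx ht
  rcases le_total x 1 with h | h
  · refine integrableOn_Ioi_deriv_of_nonpos' hderiv (fun t (ht : 0 < t) => sub_nonpos.2 ?_)
      (tendsto_log_add_sub_log_add x)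
    gcongr
  · refine integrableOn_Ioi_deriv_of_nonneg' hderiv (fun t (ht : 0 < t) => sub_nonneg.2 ?_)
      (tendsto_log_add_sub_log_add x)
    gcongr

theorem integral_inv_sub_inv {x : ℝ} (hx : 0 < x) :
    ∫ t in Set.Ioi (0 : ℝ), (1 / (1 + t) - 1 / (x + t)) = Real.log x := by
  rw [integral_Ioi_of_hasDerivAt_of_tendsto'
    (fun t ht => hasDerivAt_log_add_sub_log_add hx ht) (integrableOn_inv_sub_inv hx)
    (tendsto_log_add_sub_log_add x)]
  simp

/-- The function of `t > 0` whose integral extends the subentropy expression continuously to all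
vectors `μ` with nonnegative entries. -/
noncomputable def subentropyIntegrand {ι : Type*} [Fintype ι] (μ : ι → ℝ) (t : ℝ) : ℝ :=
  1 - (∑ i, μ i) / (1 + t) - ∏ i, t / (t + μ i)

theorem subentropyExpr_eq_integral {d : ℕ} {μ : Fin d → ℝ} (hμ : Function.Injective μ)
    (hpos : ∀ i, 0 < μ i) :
    subentropyExpr μ = ∫ t in Set.Ioi (0 : ℝ), subentropyIntegrand μ t := by
  have hsum := sum_pow_card_div_prod_sub hμ.injOn (s := Finset.univ)
  have hIntegrand : ∀ t ∈ Set.Ioi (0 : ℝ), subentropyIntegrand μ t =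
      -∑ i, μ i ^ d / (∏ j ∈ Finset.univ.erase i, (μ i - μ j)) *
        (1 / (1 + t) - 1 / (μ i + t)) := by
    intro t ht
    have hprod := sum_pow_card_div_prod_sub_mul_inv_add hμ.injOn (s := Finset.univ)
      fun i _ => (add_pos (hpos i) ht).ne'
    rw [Finset.card_univ, Fintype.card_fin] at hsum hprod
    simp only [mul_sub, Finset.sum_sub_distrib]
    rw [hprod, ← Finset.sum_mul, hsum, subentropyIntegrand]
    ring
  rw [setIntegral_congr_fun measurableSet_Ioi hIntegrand, integral_neg,
    integral_finsetSum _ fun i _ => (integrableOn_inv_sub_inv (hpos i)).const_mul _]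
  simp only [integral_const_mul, integral_inv_sub_inv (hpos _), subentropyExpr]

section Integrand

variable {ι : Type*} {μ : ι → ℝ} {t : ℝ}

theorem prod_div_add_le (s : Finset ι) (hμ : ∀ i ∈ s, 0 ≤ μ i) (ht : 0 < t) :
    ∏ i ∈ s, t / (t + μ i) ≤ t / (t + ∑ i ∈ s, μ i) := by
  induction s using Finset.cons_induction with
  | empty => simp [ht.ne']
  | cons i s hi ih =>
    rw [Finset.forall_mem_cons] at hμ
    rw [Finset.prod_cons, Finset.sum_cons]
    have hi0 := hμ.1
    have hS : 0 ≤ ∑ j ∈ s, μ j := Finset.sum_nonneg hμ.2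
    calc t / (t + μ i) * ∏ j ∈ s, t / (t + μ j)
        ≤ t / (t + μ i) * (t / (t + ∑ j ∈ s, μ j)) := by gcongr; exact ih hμ.2
      _ ≤ t / (t + (μ i + ∑ j ∈ s, μ j)) := by
        rw [div_mul_div_comm, div_le_div_iff₀ (by positivity) (by positivity)]
        nlinarith [mul_nonneg ht.le (mul_nonneg hi0 hS)]

theorem one_sub_div_le_prod (s : Finset ι) (hμ : ∀ i ∈ s, 0 ≤ μ i) (ht : 0 < t) :
    1 - (∑ i ∈ s, μ i) / t ≤ ∏ i ∈ s, t / (t + μ i) := by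
  induction s using Finset.cons_induction with
  | empty => simp
  | cons i s hi ih =>
    rw [Finset.forall_mem_cons] at hμ
    rw [Finset.prod_cons, Finset.sum_cons]
    have hi0 := hμ.1
    have hprod : ∏ j ∈ s, t / (t + μ j) ≤ 1 := by
      refine Finset.prod_le_one (fun j hj => ?_) fun j hj => ?_ <;> have hj0 := hμ.2 j hj
      · positivity
      · exact div_le_one_of_le₀ (by linarith) (by positivity)
    have hfactor : t / (t + μ i) = 1 - μ i / (t + μ i) := by
      rw [eq_sub_iff_add_eq, ← add_div, div_self (by positivity)]
    have hdiv : μ i / (t + μ i) ≤ μ i / t := by gcongr; linarith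
    have hdiv0 : 0 ≤ μ i / (t + μ i) := by positivity
    rw [hfactor, add_div]
    nlinarith [ih hμ.2]

variable [Fintype ι]

theorem subentropyIntegrand_comp_perm (π : Equiv.Perm ι) (μ : ι → ℝ) :
    subentropyIntegrand (μ ∘ π) = subentropyIntegrand μ := by
  ext t
  simp only [subentropyIntegrand, Function.comp_apply]
  rw [Equiv.sum_comp π μ, Equiv.prod_comp π fun i => t / (t + μ i)]

theorem abs_subentropyIntegrand_le (hμ : ∀ i, 0 ≤ μ i) (ht : 0 < t) :
    |subentropyIntegrand μ t| ≤ (1 + ∑ i, μ i) ^ 2 * (1 + t ^ 2)⁻¹ := by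
  have hle := prod_div_add_le Finset.univ (fun i _ => hμ i) ht
  have hge := one_sub_div_le_prod Finset.univ (fun i _ => hμ i) ht
  have hS : 0 ≤ ∑ i, μ i := Finset.sum_nonneg fun i _ => hμ i
  have hP : 0 ≤ ∏ i, t / (t + μ i) :=
    Finset.prod_nonneg fun i _ => div_nonneg ht.le (add_nonneg ht.le (hμ i))
  unfold subentropyIntegrand
  generalize ∏ i, t / (t + μ i) = P at *
  generalize ∑ i, μ i = S at *
  rw [← div_eq_mul_inv, le_div_iff₀ (by positivity), ← abs_of_pos (by positivity : 0 < 1 + t ^ 2),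
    ← abs_mul, abs_le]
  constructor
  · have hdiff : 1 - S / (1 + t) - t / (t + S) = S * (1 - S) / ((t + S) * (1 + t)) := by
      field_simp
      ring
    have hbound : -(1 + S) ^ 2 ≤ S * (1 - S) / ((t + S) * (1 + t)) * (1 + t ^ 2) := by
      rw [div_mul_eq_mul_div, le_div_iff₀ (by positivity)]
      have : 0 ≤ S * t := by positivity
      have : 0 ≤ S ^ 2 * t := by positivity
      have : 0 ≤ S ^ 3 * t := by positivity
      have : 0 ≤ S * t ^ 2 := by positivity
      have : 0 ≤ S ^ 3 := by positivity
      nlinarith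
    exact hbound.trans (by gcongr; linarith)
  · have hdiff : S / t - S / (1 + t) = S / (t * (1 + t)) := by
      field_simp
      ring
    have hbound : S / (t * (1 + t)) * t ^ 2 ≤ S := by
      rw [div_mul_eq_mul_div, div_le_iff₀ (by positivity)]
      nlinarith [mul_nonneg hS ht.le]
    have hone : 1 - S / (1 + t) - P ≤ 1 := by linarith [div_nonneg hS (by linarith : 0 ≤ 1 + t)]
    have htwo : (1 - S / (1 + t) - P) * t ^ 2 ≤ S / (t * (1 + t)) * t ^ 2 := by
      gcongr
      linarith
    nlinarith

theorem measurable_subentropyIntegrand (μ : ι → ℝ) : Measurable (subentropyIntegrand μ) := by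
  unfold subentropyIntegrand
  fun_prop

theorem integrableOn_subentropyIntegrand (hμ : ∀ i, 0 ≤ μ i) :
    IntegrableOn (subentropyIntegrand μ) (Set.Ioi 0) := by
  refine Integrable.mono' (integrable_inv_one_add_sq.restrict.const_mul ((1 + ∑ i, μ i) ^ 2))
    (measurable_subentropyIntegrand μ).aestronglyMeasurable ?_
  filter_upwards [ae_restrict_mem measurableSet_Ioi] with t ht
  exact abs_subentropyIntegrand_le hμ ht

theorem continuousAt_subentropyIntegrand (hμ : ∀ i, 0 ≤ μ i) (ht : 0 < t) :
    ContinuousAt (fun μ => subentropyIntegrand μ t) μ := by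
  have hne (i : ι) : t + μ i ≠ 0 := (add_pos_of_pos_of_nonneg ht (hμ i)).ne'
  have hprod : ContinuousAt (fun μ : ι → ℝ => ∏ i, t / (t + μ i)) μ :=
    tendsto_finsetProd _ fun i _ =>
      continuousAt_const.div (Continuous.continuousAt (by fun_prop)) (hne i)
  unfold subentropyIntegrand
  fun_prop

theorem tendsto_integral_subentropyIntegrand (hμ : ∀ i, 0 ≤ μ i) :
    Tendsto (fun ν => ∫ t in Set.Ioi (0 : ℝ), subentropyIntegrand ν t)
      (𝓝[{ν | ∀ i, 0 ≤ ν i}] μ) (𝓝 (∫ t in Set.Ioi (0 : ℝ), subentropyIntegrand μ t)) := by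
  refine tendsto_integral_filter_of_dominated_convergence
    (fun t => (1 + (∑ i, μ i + 1)) ^ 2 * (1 + t ^ 2)⁻¹)
    (Eventually.of_forall fun ν => (measurable_subentropyIntegrand ν).aestronglyMeasurable) ?_
    (integrable_inv_one_add_sq.restrict.const_mul _) ?_
  · have hsum : ∀ᶠ ν : ι → ℝ in 𝓝 μ, ∑ i, ν i < ∑ i, μ i + 1 :=
      ContinuousAt.eventually_lt (by fun_prop) continuousAt_const (lt_add_one _)
    filter_upwards [self_mem_nhdsWithin, nhdsWithin_le_nhds hsum] with ν hν hlt
    have hS : 0 ≤ ∑ i, ν i := Finset.sum_nonneg fun i _ => hν i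
    filter_upwards [ae_restrict_mem measurableSet_Ioi] with t ht
    refine (abs_subentropyIntegrand_le hν ht).trans ?_
    gcongr
  · filter_upwards [ae_restrict_mem measurableSet_Ioi] with t ht
    exact (continuousAt_subentropyIntegrand hμ ht).tendsto.mono_left nhdsWithin_le_nhds

end Integrand

section Concavity

variable {ι : Type*} [Fintype ι]

-- The logarithm of the product is convex, hence so is the product.
theorem convexOn_prod_div_add {t : ℝ} (ht : 0 < t) :
    ConvexOn ℝ (Set.univ.pi fun _ : ι => Set.Ici 0) fun v => ∏ i, t / (t + v i) := by
  have hlog : ConcaveOn ℝ (Set.Ici 0) fun x => Real.log (t⁻¹ * (x + t)) :=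
    concaveOn_log_of_pos (((concaveOn_id (convex_Ici 0)).add_const t).smul (inv_nonneg.2 ht.le))
      fun x hx => mul_pos (inv_pos.2 ht) (add_pos_of_nonneg_of_pos hx ht)
  have hsum := (concaveOn_sum_apply (ι := ι) hlog).neg
  have hexp : ConvexOn ℝ (Set.univ.pi fun _ : ι => Set.Ici 0)
      fun v => Real.exp (-∑ i, Real.log (t⁻¹ * (v i + t))) :=
    ⟨hsum.1, fun v hv w hw a b ha hb hab =>
      (Real.exp_le_exp.2 (hsum.2 hv hw ha hb hab)).trans
        (convexOn_exp.2 trivial trivial ha hb hab)⟩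
  refine hexp.congr fun v hv => ?_
  simp only
  rw [← Finset.sum_neg_distrib, Real.exp_sum]
  refine Finset.prod_congr rfl fun i _ => ?_
  have hvt : 0 < v i + t := add_pos_of_nonneg_of_pos (hv i trivial) ht
  rw [Real.exp_neg, Real.exp_log (mul_pos (inv_pos.2 ht) hvt), mul_inv, inv_inv, add_comm t,
    div_eq_mul_inv]

theorem concaveOn_subentropyIntegrand {t : ℝ} (ht : 0 < t) :
    ConcaveOn ℝ (Set.univ.pi fun _ : ι => Set.Ici 0) fun v => subentropyIntegrand v t := by
  have hprod := convexOn_prod_div_add (ι := ι) ht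
  refine ConcaveOn.sub ⟨hprod.1, fun v _ w _ a b _ _ hab => le_of_eq ?_⟩ hprod
  simp only [Pi.add_apply, Pi.smul_apply, smul_eq_mul, Finset.sum_add_distrib, ← Finset.mul_sum]
  linear_combination hab

theorem concaveOn_integral {α E : Type*} [MeasurableSpace α] {m : Measure α} [AddCommGroup E]
    [Module ℝ E] {s : Set E} {f : E → α → ℝ} (hs : Convex ℝ s)
    (hf : ∀ᵐ t ∂m, ConcaveOn ℝ s fun x => f x t) (hint : ∀ x ∈ s, Integrable (f x) m) :
    ConcaveOn ℝ s fun x => ∫ t, f x t ∂m := by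
  refine ⟨hs, fun x hx y hy a b ha hb hab => ?_⟩
  have hadd := integral_add ((hint x hx).smul a) ((hint y hy).smul b)
  simp only [Pi.smul_apply, integral_smul] at hadd
  rw [← hadd]
  refine integral_mono_ae (((hint x hx).smul a).add ((hint y hy).smul b))
    (hint _ (hs hx hy ha hb hab)) ?_
  filter_upwards [hf] with t ht
  exact ht.2 hx hy ha hb hab

theorem concaveOn_integral_subentropyIntegrand :
    ConcaveOn ℝ (Set.univ.pi fun _ : ι => Set.Ici 0)
      fun v => ∫ t in Set.Ioi (0 : ℝ), subentropyIntegrand v t := by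
  refine concaveOn_integral (convex_pi fun _ _ => convex_Ici 0) ?_
    fun v hv => integrableOn_subentropyIntegrand fun i => hv i trivial
  filter_upwards [ae_restrict_mem measurableSet_Ioi] with t ht
  exact concaveOn_subentropyIntegrand ht

end Concavity

section Limit

variable {d : ℕ}

-- Along `v i + ε * (i + 1)`, two coordinates agree for at most one value of `ε`.
theorem neBot_nhdsWithin_injective_pos {v : Fin d → ℝ} (hv : ∀ i, 0 ≤ v i) :
    (𝓝[{μ : Fin d → ℝ | Function.Injective μ ∧ ∀ i, 0 < μ i}] v).NeBot := by
  rw [← mem_closure_iff_nhdsWithin_neBot]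
  have hlim : Tendsto (fun (ε : ℝ) (i : Fin d) => v i + ε * (i + 1)) (𝓝[>] 0) (𝓝 v) := by
    refine Tendsto.mono_left ?_ nhdsWithin_le_nhds
    have hcont : Continuous fun (ε : ℝ) (i : Fin d) => v i + ε * (i + 1) := by fun_prop
    simpa using hcont.tendsto 0
  have hinj : ∀ᶠ ε : ℝ in 𝓝[>] 0, ∀ i j : Fin d,
      v i + ε * (i + 1) = v j + ε * (j + 1) → i = j := by
    refine eventually_all.2 fun i => eventually_all.2 fun j => ?_
    have hne : ∀ᶠ ε : ℝ in 𝓝[>] 0, ε ≠ (v j - v i) / ((i : ℝ) - j) :=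
      (nhdsGT_le_nhdsNE 0).trans (nhdsNE_le_cofinite 0) (Set.finite_singleton _).compl_mem_cofinite
    filter_upwards [hne] with ε hε heq
    by_contra hij
    have hij' : (i : ℝ) - j ≠ 0 := sub_ne_zero.2 fun h => hij (Fin.ext (Nat.cast_injective h))
    exact hε ((eq_div_iff hij').2 (by linear_combination heq))
  refine mem_closure_of_tendsto hlim ?_
  filter_upwards [self_mem_nhdsWithin, hinj] with ε (hε : 0 < ε) hinj
  exact ⟨hinj, fun i => add_pos_of_nonneg_of_pos (hv i) (by positivity)⟩

theorem tendsto_subentropyExpr {v : Fin d → ℝ} (hv : ∀ i, 0 ≤ v i) :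
    Tendsto subentropyExpr (𝓝[{μ | Function.Injective μ ∧ ∀ i, 0 < μ i}] v)
      (𝓝 (∫ t in Set.Ioi (0 : ℝ), subentropyIntegrand v t)) := by
  refine ((tendsto_integral_subentropyIntegrand hv).mono_left
    (nhdsWithin_mono _ fun μ hμ i => (hμ.2 i).le)).congr' ?_
  filter_upwards [self_mem_nhdsWithin] with μ hμ
  exact (subentropyExpr_eq_integral hμ.1 hμ.2).symm

variable {ρ : Matrix (Fin d) (Fin d) ℂ}

theorem subentropy_eq_integral (hρ : ρ ∈ densityMatrices d) :
    subentropy ρ = ∫ t in Set.Ioi (0 : ℝ), subentropyIntegrand (spectrumVec ρ) t :=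
  have hρ0 := (mem_densityMatrices_iff.1 hρ).2.1
  haveI := neBot_nhdsWithin_injective_pos hρ0
  (tendsto_subentropyExpr hρ0).limUnder_eq

theorem tendsto_subentropy (hρ : ρ ∈ densityMatrices d) :
    (genericNhds ρ).NeBot ∧ Tendsto subentropyExpr (genericNhds ρ) (𝓝 (subentropy ρ)) := by
  have hρ0 := (mem_densityMatrices_iff.1 hρ).2.1
  rw [subentropy_eq_integral hρ]
  exact ⟨neBot_nhdsWithin_injective_pos hρ0, tendsto_subentropyExpr hρ0⟩

theorem subentropy_mem_classF (d : ℕ) : subentropy ∈ classF d := by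
  refine mem_classF_of_concaveOn_stdSimplex
    (concaveOn_integral_subentropyIntegrand.subset (stdSimplex_subset_pi_Ici _)
      (convex_stdSimplex ℝ _)) (fun π v => ?_) fun ρ => subentropy_eq_integral
  rw [subentropyIntegrand_comp_perm]

end Limit

end Subentropy

end QuditEPI

theorem theorem1 (d : ℕ) :
    -- the entropy power inequality for the whole class
    (∀ f ∈ QuditEPI.classF d, ∀ ρ ∈ QuditEPI.densityMatrices d,
      ∀ σ ∈ QuditEPI.densityMatrices d, ∀ a ∈ Set.Icc (0 : ℝ) 1,
        QuditEPI.boxplus a ρ σ ∈ QuditEPI.densityMatrices d ∧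
        f (QuditEPI.boxplus a ρ σ) ≥ a * f ρ + (1 - a) * f σ) ∧
    -- members of the class
    QuditEPI.vonNeumannEntropy ∈ QuditEPI.classF d ∧
    (∀ α ∈ Set.Ico (0 : ℝ) 1, QuditEPI.renyiEntropy α ∈ QuditEPI.classF d) ∧
    -- the limit that defines the subentropy exists
    (∀ ρ ∈ QuditEPI.densityMatrices d, (QuditEPI.genericNhds ρ).NeBot ∧
      Filter.Tendsto QuditEPI.subentropyExpr (QuditEPI.genericNhds ρ)
        (nhds (QuditEPI.subentropy ρ))) ∧
    QuditEPI.subentropy ∈ QuditEPI.classF d := by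
  exact ⟨fun _ hf _ hρ _ hσ _ ha =>
      ⟨QuditEPI.boxplus_mem_densityMatrices hρ hσ ha, QuditEPI.le_boxplus hf hρ hσ ha⟩,
    QuditEPI.vonNeumannEntropy_mem_classF d,
    fun _ hα => QuditEPI.renyiEntropy_mem_classF d hα,
    fun _ hρ => QuditEPI.tendsto_subentropy hρ,
    QuditEPI.subentropy_mem_classF d⟩
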